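/- Let $\mathcal H$ be a complex Hilbert space (inner product linear in the second argument) and let $S$ be a strictly positive symmetric operator on $\mathcal H$, i.e. $S$ is densely defined, symmetric, and there is $\varepsilon>0$ with $\langle f,Sf\rangle\ge\varepsilon\|f\|^2$ for all $f\in\mathcal D(S)$. Let $S_F$ be its Friedrichs extension: the restriction of $S^*$ to those $f\in\mathcal D(S^*)$ for which there are $f_n\in\mathcal D(S)$ with $f_n\to f$ and $\langle f_n-f_m,S(f_n-f_m)\rangle\to0$ as $n,m\to\infty$. Let $S_K$ be its Kreĭn–von Neumann extension: the restriction of $S^*$ to $\mathcal D(\overline S)\dot+\ker S^*$. Then $S_F$ is a strictly positive selfadjoint extension of $S$ and $S_K$ is non-negative and selfadjoint, so that the non-negative selfadjoint square roots $S_F^{1/2}$ and $S_K^{1/2}$ exist. Put $A=iS$. Then $A$ is dissipative (densely defined with $\operatorname{Im}\langle f,Af\rangle\ge0$ for $f\in\mathcal D(A)$), and the quadratic form $q_A(f)=\operatorname{Im}\langle f,Af\rangle$, $\mathcal D(q_A)=\mathcal D(A)$, is closable. Let $V_A$ be the non-negative selfadjoint operator associated with the closure of $q_A$. Then $$V_A=S_F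 .$$ Let $W_A$ be the operator with domain $\mathcal D(W_A)=\operatorname{ran}(V_A^{1/2}\upharpoonright_{\mathcal D(A)})$ and $W_Ag=AV_A^{-1/2}g$. It is densely defined, and its adjoint $W_A^*$ is given by $$\mathcal D(W_A^*)=\mathcal D(S_K^{1/2})=\mathcal D(S_F^{1/2})\dot+\ker S^*,\qquad W_A^*f=-iS_F^{1/2}\mathcal Pf,$$ where the sum is direct ($\mathcal D(S_F^{1/2})\cap\ker S^*=\{0\}$) and $\mathcal P$ is the projection onto $\mathcal D(S_F^{1/2})$ along $\ker S^*$, defined on $\mathcal D(S_F^{1/2})\dot+\ker S^*$. In particular, every accretive extension $B$ of $S$ (an extension such that $iB$ is dissipative) satisfies $\mathcal D(B)\subset\mathcal D(S_K^{1/2})$. -/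

import Mathlib

open Filter Topology ComplexConjugate

noncomputable section

/-- A non-negative (Hermitian) form on a subspace of a complex inner product space `H`,
conjugate-linear in the first and linear in the second argument. -/
structure NonnegForm (H : Type*) [NormedAddCommGroup H] [InnerProductSpace ℂ H] where
  /-- the domain of the form -/
  domain : Submodule ℂ H
  /-- the sesquilinear form -/
  form : domain →ₗ⋆[ℂ] domain →ₗ[ℂ] ℂ
  hermitian : ∀ f g, conj (form f g) = form g f
  nonneg : ∀ f, 0 ≤ (form f f).re

namespace NonnegForm

variable {H : Type*} [NormedAddCommGroup H] [InnerProductSpace ℂ H]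

/-- The quadratic form `q(f) = q(f, f)`. -/
def quad (q : NonnegForm H) (f : q.domain) : ℝ := (q.form f f).re

/-- `u n → f` in `H` and `q (u n - u m) → 0` as `n, m → ∞`. -/
def Approx (q : NonnegForm H) (u : ℕ → q.domain) (f : H) : Prop :=
  Tendsto (fun n => (u n : H)) atTop (𝓝 f) ∧
    Tendsto (fun p : ℕ × ℕ => q.quad (u p.1 - u p.2)) atTop (𝓝 0)

/-- The form `q` is closable: if `u n → 0` in `H` and `q (u n - u m) → 0`, then `q (u n) → 0`. -/
def IsClosable (q : NonnegForm H) : Prop :=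
  ∀ u : ℕ → q.domain, Tendsto (fun n => ‖(u n : H)‖) atTop (𝓝 0) →
    Tendsto (fun p : ℕ × ℕ => q.quad (u p.1 - u p.2)) atTop (𝓝 0) →
    Tendsto (fun n => q.quad (u n)) atTop (𝓝 0)

theorem ofReal_quad (q : NonnegForm H) (f : q.domain) : (q.quad f : ℂ) = q.form f f :=
  Complex.conj_eq_iff_re.1 (q.hermitian f f)

theorem quad_nonneg (q : NonnegForm H) (f : q.domain) : 0 ≤ q.quad f := q.nonneg f

theorem quad_smul (q : NonnegForm H) (c : ℂ) (f : q.domain) :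
    q.quad (c • f) = ‖c‖ ^ 2 * q.quad f := by
  apply Complex.ofReal_injective
  rw [Complex.ofReal_mul, ofReal_quad, ofReal_quad]
  simp only [map_smulₛₗ, LinearMap.smul_apply, smul_eq_mul, RingHom.id_apply]
  rw [← mul_assoc, mul_comm c, Complex.conj_mul']
  push_cast
  ring

theorem quad_add_add_quad_sub (q : NonnegForm H) (f g : q.domain) :
    q.quad (f + g) + q.quad (f - g) = 2 * q.quad f + 2 * q.quad g := by
  simp only [quad, map_add, map_sub, LinearMap.add_apply, LinearMap.sub_apply, Complex.add_re,
    Complex.sub_re]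
  ring

theorem quad_add_le (q : NonnegForm H) (f g : q.domain) :
    q.quad (f + g) ≤ 2 * q.quad f + 2 * q.quad g := by
  linarith [q.quad_add_add_quad_sub f g, q.quad_nonneg (f - g)]

theorem polarization (q : NonnegForm H) (f g : q.domain) :
    q.form f g = ((q.quad (f + g) : ℂ) - q.quad (f - g)
      - Complex.I * q.quad (f + Complex.I • g) + Complex.I * q.quad (f - Complex.I • g)) / 4 := by
  simp only [ofReal_quad, map_add, map_sub, LinearMap.add_apply, LinearMap.sub_apply, map_smulₛₗ,
    LinearMap.smul_apply, smul_eq_mul, RingHom.id_apply, Complex.conj_I]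
  linear_combination ((q.form f g - q.form g f) / 2) * Complex.I_sq

/-- The semi-inner product given by the form. -/
@[reducible] def core (q : NonnegForm H) : PreInnerProductSpace.Core ℂ q.domain where
  inner f g := q.form f g
  conj_inner_symm f g := q.hermitian g f
  re_inner_nonneg f := q.nonneg f
  add_left f g h := by simp
  smul_left f g c := by simp

theorem sqrt_quad_add_le (q : NonnegForm H) (f g : q.domain) :
    √(q.quad (f + g)) ≤ √(q.quad f) + √(q.quad g) := by
  let _ := q.core
  let _ := InnerProductSpace.Core.toSeminormedAddCommGroup (𝕜 := ℂ) (F := q.domain)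
  exact norm_add_le f g

theorem abs_sqrt_quad_sub_le (q : NonnegForm H) (f g : q.domain) :
    |√(q.quad f) - √(q.quad g)| ≤ √(q.quad (f - g)) := by
  have h1 := q.sqrt_quad_add_le (f - g) g
  have h2 := q.sqrt_quad_add_le (g - f) f
  have h3 : q.quad (g - f) = q.quad (f - g) := by
    have := q.quad_smul (-1) (f - g)
    simpa using this
  rw [sub_add_cancel] at h1 h2
  rw [h3] at h2
  rw [abs_le]
  constructor <;> linarith

theorem approx_const (q : NonnegForm H) (f : q.domain) : q.Approx (fun _ => f) (f : H) := by
  refine ⟨tendsto_const_nhds, ?_⟩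
  simp [quad]

theorem Approx.add {q : NonnegForm H} {u v : ℕ → q.domain} {f g : H} (hu : q.Approx u f)
    (hv : q.Approx v g) : q.Approx (fun n => u n + v n) (f + g) := by
  refine ⟨hu.1.add hv.1, ?_⟩
  have h := (hu.2.const_mul 2).add (hv.2.const_mul 2)
  simp only [mul_zero, add_zero] at h
  refine squeeze_zero (fun p => q.quad_nonneg _) (fun p => ?_) h
  rw [add_sub_add_comm]
  exact q.quad_add_le _ _

theorem Approx.smul {q : NonnegForm H} {u : ℕ → q.domain} {f : H} (c : ℂ) (hu : q.Approx u f) :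
    q.Approx (fun n => c • u n) (c • f) := by
  refine ⟨hu.1.const_smul c, ?_⟩
  have h := hu.2.const_mul (‖c‖ ^ 2)
  simp only [mul_zero] at h
  refine h.congr fun p => ?_
  rw [← smul_sub, quad_smul]

theorem Approx.sub {q : NonnegForm H} {u v : ℕ → q.domain} {f g : H} (hu : q.Approx u f)
    (hv : q.Approx v g) : q.Approx (fun n => u n - v n) (f - g) := by
  have h := hu.add (hv.smul (-1))
  simpa [sub_eq_add_neg] using h

/-- The domain of the closure of `q`. -/
def closureDomain (q : NonnegForm H) : Submodule ℂ H where
  carrier := {f | ∃ u : ℕ → q.domain, q.Approx u f}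
  zero_mem' := ⟨fun _ => 0, q.approx_const 0⟩
  add_mem' := fun ⟨_, hu⟩ ⟨_, hv⟩ => ⟨_, hu.add hv⟩
  smul_mem' := fun c _ ⟨_, hu⟩ => ⟨_, hu.smul c⟩

theorem Approx.exists_tendsto_quad {q : NonnegForm H} {u : ℕ → q.domain} {f : H}
    (hu : q.Approx u f) : ∃ a : ℝ, Tendsto (fun n => q.quad (u n)) atTop (𝓝 a) := by
  have hc : CauchySeq (fun n => √(q.quad (u n))) := by
    rw [cauchySeq_iff_tendsto_dist_atTop_0]
    have h := (Real.continuous_sqrt.tendsto 0).comp hu.2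
    rw [Real.sqrt_zero] at h
    exact squeeze_zero (fun _ => dist_nonneg) (fun p => q.abs_sqrt_quad_sub_le _ _) h
  obtain ⟨b, hb⟩ := cauchySeq_tendsto_of_complete hc
  refine ⟨b ^ 2, (hb.pow 2).congr fun n => ?_⟩
  exact Real.sq_sqrt (q.quad_nonneg _)

theorem Approx.tendsto_quad_of_tendsto {q : NonnegForm H} (hq : q.IsClosable)
    {u v : ℕ → q.domain} {f : H} (hu : q.Approx u f) (hv : q.Approx v f) {a : ℝ}
    (ha : Tendsto (fun n => q.quad (u n)) atTop (𝓝 a)) :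
    Tendsto (fun n => q.quad (v n)) atTop (𝓝 a) := by
  have hd : q.Approx (fun n => v n - u n) (f - f) := hv.sub hu
  rw [sub_self] at hd
  have h0 : Tendsto (fun n => q.quad (v n - u n)) atTop (𝓝 0) :=
    hq (fun n => v n - u n) (tendsto_zero_iff_norm_tendsto_zero.1 hd.1) hd.2
  have h1 : Tendsto (fun n => √(q.quad (v n - u n))) atTop (𝓝 0) := by
    simpa using h0.sqrt
  have h2 : Tendsto (fun n => √(q.quad (v n)) - √(q.quad (u n))) atTop (𝓝 0) :=
    squeeze_zero_norm (fun n => q.abs_sqrt_quad_sub_le (v n) (u n)) h1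
  have h3 : Tendsto (fun n => √(q.quad (v n))) atTop (𝓝 (√a)) := by
    simpa using h2.add ha.sqrt
  have ha0 : 0 ≤ a := ge_of_tendsto' ha fun n => q.quad_nonneg (u n)
  have h4 := h3.pow 2
  rw [Real.sq_sqrt ha0] at h4
  exact h4.congr fun n => Real.sq_sqrt (q.quad_nonneg (v n))

theorem Approx.exists_tendsto_form {q : NonnegForm H} (hq : q.IsClosable) {u v : ℕ → q.domain}
    {f g : H} (hu : q.Approx u f) (hv : q.Approx v g) :
    ∃ a : ℂ, ∀ u' v' : ℕ → q.domain, q.Approx u' f → q.Approx v' g →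
      Tendsto (fun n => q.form (u' n) (v' n)) atTop (𝓝 a) := by
  obtain ⟨a, ha⟩ := (hu.add hv).exists_tendsto_quad
  obtain ⟨b, hb⟩ := (hu.sub hv).exists_tendsto_quad
  obtain ⟨c, hc⟩ := (hu.add (hv.smul Complex.I)).exists_tendsto_quad
  obtain ⟨d, hd⟩ := (hu.sub (hv.smul Complex.I)).exists_tendsto_quad
  refine ⟨((a : ℂ) - b - Complex.I * c + Complex.I * d) / 4, fun u' v' hu' hv' => ?_⟩
  have ha' := (hu.add hv).tendsto_quad_of_tendsto hq (hu'.add hv') ha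
  have hb' := (hu.sub hv).tendsto_quad_of_tendsto hq (hu'.sub hv') hb
  have hc' := (hu.add (hv.smul Complex.I)).tendsto_quad_of_tendsto hq
    (hu'.add (hv'.smul Complex.I)) hc
  have hd' := (hu.sub (hv.smul Complex.I)).tendsto_quad_of_tendsto hq
    (hu'.sub (hv'.smul Complex.I)) hd
  have cast : ∀ {w : ℕ → ℝ} {x : ℝ}, Tendsto w atTop (𝓝 x) →
      Tendsto (fun n => (w n : ℂ)) atTop (𝓝 (x : ℂ)) :=
    fun h => (Complex.continuous_ofReal.tendsto _).comp h
  simp only [polarization]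
  exact ((((cast ha').sub (cast hb')).sub ((cast hc').const_mul _)).add
    ((cast hd').const_mul _)).div_const 4

/-- The value `q'(f, g) = lim q(u n, v n)`, for any `u n → f`, `v n → g` as in `Approx`. -/
def closureVal (q : NonnegForm H) (f g : q.closureDomain) : ℂ :=
  limUnder atTop fun n => q.form (f.2.choose n) (g.2.choose n)

theorem tendsto_closureVal (q : NonnegForm H) (hq : q.IsClosable) (f g : q.closureDomain)
    {u v : ℕ → q.domain} (hu : q.Approx u f) (hv : q.Approx v g) :
    Tendsto (fun n => q.form (u n) (v n)) atTop (𝓝 (q.closureVal f g)) := by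
  obtain ⟨a, ha⟩ := hu.exists_tendsto_form hq hv
  have h : q.closureVal f g = a := (ha _ _ f.2.choose_spec g.2.choose_spec).limUnder_eq
  rw [h]
  exact ha u v hu hv

/-- The closure `q'` of a closable form `q`. -/
def closure (q : NonnegForm H) (hq : q.IsClosable) : NonnegForm H where
  domain := q.closureDomain
  form := LinearMap.mk₂'ₛₗ (starRingEnd ℂ) (RingHom.id ℂ) q.closureVal
    (by
      intro f f' g
      obtain ⟨u, hu⟩ := f.2
      obtain ⟨u', hu'⟩ := f'.2
      obtain ⟨v, hv⟩ := g.2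
      refine tendsto_nhds_unique (q.tendsto_closureVal hq (f + f') g (hu.add hu') hv) ?_
      simpa using (q.tendsto_closureVal hq f g hu hv).add (q.tendsto_closureVal hq f' g hu' hv))
    (by
      intro c f g
      obtain ⟨u, hu⟩ := f.2
      obtain ⟨v, hv⟩ := g.2
      refine tendsto_nhds_unique (q.tendsto_closureVal hq (c • f) g (hu.smul c) hv) ?_
      simpa using (q.tendsto_closureVal hq f g hu hv).const_mul (conj c))
    (by
      intro f g g'
      obtain ⟨u, hu⟩ := f.2
      obtain ⟨v, hv⟩ := g.2
      obtain ⟨v', hv'⟩ := g'.2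
      refine tendsto_nhds_unique (q.tendsto_closureVal hq f (g + g') hu (hv.add hv')) ?_
      simpa using (q.tendsto_closureVal hq f g hu hv).add (q.tendsto_closureVal hq f g' hu hv'))
    (by
      intro c f g
      obtain ⟨u, hu⟩ := f.2
      obtain ⟨v, hv⟩ := g.2
      refine tendsto_nhds_unique (q.tendsto_closureVal hq f (c • g) hu (hv.smul c)) ?_
      simpa using (q.tendsto_closureVal hq f g hu hv).const_mul c)
  hermitian := by
    intro f g
    obtain ⟨u, hu⟩ := f.2
    obtain ⟨v, hv⟩ := g.2
    refine tendsto_nhds_unique ((Complex.continuous_conj.tendsto _).comp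
      (q.tendsto_closureVal hq f g hu hv)) ?_
    exact (q.tendsto_closureVal hq g f hv hu).congr fun n => (q.hermitian _ _).symm
  nonneg := by
    intro f
    obtain ⟨u, hu⟩ := f.2
    exact ge_of_tendsto' ((Complex.continuous_re.tendsto _).comp
      (q.tendsto_closureVal hq f f hu hu)) fun n => q.nonneg _

/-- The operator `T` associated with the form `q`: `f ∈ D(T)` and `T f = h` if and only if
`f ∈ D(q)` and `q(g, f) = ⟪g, h⟫` for all `g ∈ D(q)`. (For a closed, densely defined `q` this is
the non-negative selfadjoint operator of the representation theorem.) -/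
def toOperator (q : NonnegForm H) : H →ₗ.[ℂ] H :=
  Submodule.toLinearPMap
    { carrier := {p | ∃ hf : p.1 ∈ q.domain,
        ∀ g : q.domain, q.form g ⟨p.1, hf⟩ = inner ℂ (g : H) p.2}
      zero_mem' := ⟨q.domain.zero_mem, fun g => by
        rw [Prod.snd_zero, inner_zero_right]
        exact map_zero (q.form g)⟩
      add_mem' := fun {p r} ⟨hp, hp'⟩ ⟨hr, hr'⟩ => ⟨q.domain.add_mem hp hr, fun g => by
        have h := map_add (q.form g) ⟨p.1, hp⟩ ⟨r.1, hr⟩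
        rw [hp', hr'] at h
        simpa [inner_add_right] using h⟩
      smul_mem' := fun c p ⟨hp, hp'⟩ => ⟨q.domain.smul_mem c hp, fun g => by
        have h := map_smul (q.form g) c ⟨p.1, hp⟩
        rw [hp'] at h
        simpa [inner_smul_right] using h⟩ }

end NonnegForm

namespace LinearPMap

variable {H : Type*} [NormedAddCommGroup H] [InnerProductSpace ℂ H]

/-- Product of unbounded operators: `D(T R) = {x ∈ D(R) : R x ∈ D(T)}`, `x ↦ T (R x)`. -/
def mulOp (T R : H →ₗ.[ℂ] H) : H →ₗ.[ℂ] H :=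
  T.comp (R.domRestrict ((T.domain.comap R.toFun).map R.domain.subtype)) (by
    rintro ⟨x, ⟨y, hy, rfl⟩, hx⟩
    exact hy)

/-- The kernel of an unbounded operator, as a subspace of the whole space. -/
def kernel (T : H →ₗ.[ℂ] H) : Submodule ℂ H := (LinearMap.ker T.toFun).map T.domain.subtype

/-- The projection `u + n ↦ u` onto `U` along `N`, with domain `U + N`
(for subspaces with `U ∩ N = {0}`). -/
def projAlong (U N : Submodule ℂ H) : H →ₗ.[ℂ] H :=
  ((U.prod N).map ((LinearMap.fst ℂ H H + LinearMap.snd ℂ H H).prod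
    (LinearMap.fst ℂ H H))).toLinearPMap

/-- Dissipative operators. -/
def IsDissipative (A : H →ₗ.[ℂ] H) : Prop :=
  Dense (A.domain : Set H) ∧ ∀ f : A.domain, 0 ≤ (inner ℂ (f : H) (A f)).im

/-- Accretive operators. -/
def IsAccretive (A : H →ₗ.[ℂ] H) : Prop := (Complex.I • A).IsDissipative

/-- Strictly positive symmetric (in particular densely defined) operators. -/
def IsStrictlyPositiveSymmetric (S : H →ₗ.[ℂ] H) : Prop :=
  Dense (S.domain : Set H) ∧ S.IsFormalAdjoint S ∧
    ∃ ε : ℝ, 0 < ε ∧ ∀ f : S.domain, ε * ‖(f : H)‖ ^ 2 ≤ (inner ℂ (f : H) (S f)).re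

/-- The form `q_A(f) = Im ⟪f, A f⟫` on `D(A)` of a dissipative operator `A`; its sesquilinear
version is `(⟪f, A g⟫ - ⟪A f, g⟫) / (2 i)`. -/
def imForm (A : H →ₗ.[ℂ] H) (hA : A.IsDissipative) : NonnegForm H where
  domain := A.domain
  form := LinearMap.mk₂'ₛₗ (starRingEnd ℂ) (RingHom.id ℂ)
    (fun f g => (inner ℂ (f : H) (A g) - inner ℂ (A f) (g : H)) / (2 * Complex.I))
    (by intro f f' g; simp only [map_add, Submodule.coe_add, inner_add_left]; ring)
    (by intro c f g; simp only [map_smul, Submodule.coe_smul, inner_smul_left, smul_eq_mul]; ring)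
    (by intro f g g'; simp only [map_add, Submodule.coe_add, inner_add_right]; ring)
    (by intro c f g; simp only [map_smul, Submodule.coe_smul, inner_smul_right, smul_eq_mul,
          RingHom.id_apply]; ring)
  hermitian := by
    intro f g
    simp only [LinearMap.mk₂'ₛₗ_apply, map_div₀, map_mul, Complex.conj_I, Complex.conj_ofNat]
    rw [RingHom.map_sub, inner_conj_symm, inner_conj_symm, mul_neg, div_neg, ← neg_div, neg_sub]
  nonneg := by
    intro f
    have h : (inner ℂ (f : H) (A f) - inner ℂ (A f) (f : H)) / (2 * Complex.I)
        = ((inner ℂ (f : H) (A f)).im : ℂ) := by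
      rw [← inner_conj_symm (A f) (f : H), Complex.sub_conj]
      field_simp
      push_cast
      ring
    simp only [LinearMap.mk₂'ₛₗ_apply, h, Complex.ofReal_re]
    exact hA.2 f

/-- The imaginary part `V_A` of a dissipative operator `A` for which `q_A` is closable: the operator
associated with the closure of `q_A`. -/
def imPart (A : H →ₗ.[ℂ] H) (hA : A.IsDissipative) (hq : (A.imForm hA).IsClosable) : H →ₗ.[ℂ] H :=
  ((A.imForm hA).closure hq).toOperator

/-- The form `(f, g) ↦ ⟪f, S g⟫` on `D(S)` of a strictly positive symmetric operator `S`. -/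
def symmForm (S : H →ₗ.[ℂ] H) (hS : S.IsStrictlyPositiveSymmetric) : NonnegForm H where
  domain := S.domain
  form := LinearMap.mk₂'ₛₗ (starRingEnd ℂ) (RingHom.id ℂ)
    (fun f g => inner ℂ (f : H) (S g))
    (by intro f f' g; simp only [Submodule.coe_add, inner_add_left])
    (by intro c f g; simp only [Submodule.coe_smul, inner_smul_left, smul_eq_mul])
    (by intro f g g'; simp only [map_add, inner_add_right])
    (by intro c f g; simp only [map_smul, inner_smul_right, smul_eq_mul, RingHom.id_apply])
  hermitian := by
    intro f g
    simp only [LinearMap.mk₂'ₛₗ_apply, inner_conj_symm]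
    exact hS.2.1 g f
  nonneg := by
    intro f
    obtain ⟨ε, hε, h⟩ := hS.2.2
    simp only [LinearMap.mk₂'ₛₗ_apply]
    exact le_trans (by positivity) (h f)

variable [CompleteSpace H]

/-- `R` is a non-negative selfadjoint square root of `T`. -/
def IsNonnegSqrt (T R : H →ₗ.[ℂ] H) : Prop :=
  IsSelfAdjoint R ∧ (∀ f : R.domain, 0 ≤ (inner ℂ (f : H) (R f)).re) ∧ R.mulOp R = T

open Classical in
/-- The square root `T^{1/2}` of a non-negative selfadjoint operator `T`: its (unique) non-negative
selfadjoint square root. -/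
def sqrtOp (T : H →ₗ.[ℂ] H) : H →ₗ.[ℂ] H :=
  if h : ∃ R, IsNonnegSqrt T R then h.choose else 0

/-- The operator `W_A : ran(V_A^{1/2} restricted to D(A)) → H`, `g ↦ A V_A^{-1/2} g`. -/
def wOp (A : H →ₗ.[ℂ] H) (hA : A.IsDissipative) (hq : (A.imForm hA).IsClosable) : H →ₗ.[ℂ] H :=
  A.mulOp ((A.imPart hA hq).sqrtOp.domRestrict A.domain).inverse

/-- The Friedrichs extension `S_F`: the restriction of `S*` to `D(S*) ∩ H_S`, where `H_S` is the
completion (inside `H`) of `D(S)` in the norm given by `⟪f, S f⟫`. -/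
def friedrichs (S : H →ₗ.[ℂ] H) (hS : S.IsStrictlyPositiveSymmetric) : H →ₗ.[ℂ] H :=
  S.adjoint.domRestrict (S.symmForm hS).closureDomain

/-- The Kreĭn–von Neumann extension `S_K`: the restriction of `S*` to `D(closure of S) + ker S*`. -/
def krein (S : H →ₗ.[ℂ] H) : H →ₗ.[ℂ] H :=
  S.adjoint.domRestrict (S.closure.domain ⊔ S.adjoint.kernel)

end LinearPMap

end

/-!
Let `K` be the completion of `D(S)` in the energy norm `⟪f, S f⟫^{1/2}` and `ι : K → H` the
continuous extension of the inclusion. Everything is read off from `ι`: since `ι* (S f)` is the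
class of `f`, one has `S_F = (ι ι*)⁻¹`, and `S_K` is the Moore–Penrose inverse of `(P ι) (P ι)*`,
where `P` is the orthogonal projection onto the closure of `ran S`. As `ran (T T*)^{1/2} = ran T`
for bounded `T`, the square roots have domains `D(S_F^{1/2}) = ran ι` and
`D(S_K^{1/2}) = ran (P ι) + ker S* = ran ι + ker S*`. With `A = i S`, the form `q_A` is `⟪f, S f⟫`,
and `W_A` maps `(ι ι*)^{1/2} S f` to `i S f`, so that `(x, y)` is in the graph of `W_A*` exactly if
`x - (ι ι*)^{1/2} (i y)` is orthogonal to `ran S`. Finally, `f ∈ D(S_K^{1/2})` as soon as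
`S g ↦ ⟪f, S g⟫` is bounded in the norm `‖ι* (S g)‖ = ⟪g, S g⟫^{1/2}`; when `f` lies in the domain
of an accretive extension `B`, this is the Cauchy–Schwarz inequality for `Re ⟪·, B ·⟫`.
-/

noncomputable section

namespace UnboundedOperator

section Graph

variable {R E F : Type*} [Ring R] [AddCommGroup E] [Module R E] [AddCommGroup F] [Module R F]

theorem mem_graph_domRestrict {T : E →ₗ.[R] F} {U : Submodule R E} {x : E} {y : F} :
    (x, y) ∈ (T.domRestrict U).graph ↔ x ∈ U ∧ (x, y) ∈ T.graph := by
  constructor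
  · intro h
    exact ⟨(LinearPMap.mem_domain_of_mem_graph h).1,
      LinearPMap.le_graph_of_le LinearPMap.domRestrict_le h⟩
  · rintro ⟨hx, h⟩
    obtain ⟨a, rfl, rfl⟩ := T.mem_graph_iff.1 h
    exact (T.domRestrict U).mem_graph ⟨a, hx, a.2⟩

theorem mem_graph_smul {M : Type*} [Monoid M] [DistribMulAction M F] [SMulCommClass R M F]
    {T : E →ₗ.[R] F} {c : M} {x : E} {z : F} :
    (x, z) ∈ (c • T).graph ↔ ∃ y, (x, y) ∈ T.graph ∧ c • y = z := by
  simp only [LinearPMap.smul_graph, Submodule.mem_map, Prod.exists, LinearMap.prodMap_apply,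
    LinearMap.id_apply, LinearMap.smul_apply, Prod.mk.injEq, existsAndEq, true_and]

theorem mem_graph_inverse {T : E →ₗ.[R] F} (hT : LinearMap.ker T.toFun = ⊥) {x : F} {y : E} :
    (x, y) ∈ T.inverse.graph ↔ (y, x) ∈ T.graph := by
  simp [LinearPMap.inverse_graph hT]

end Graph

section Operations

variable {H : Type*} [NormedAddCommGroup H] [InnerProductSpace ℂ H]

theorem mem_graph_mulOp {T R : H →ₗ.[ℂ] H} {x z : H} :
    (x, z) ∈ (T.mulOp R).graph ↔ ∃ y, (x, y) ∈ R.graph ∧ (y, z) ∈ T.graph := by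
  constructor
  · intro h
    obtain ⟨⟨a, ⟨⟨b, hb, rfl⟩, hb'⟩⟩, rfl, rfl⟩ := (LinearPMap.mem_graph_iff _).1 h
    exact ⟨R b, R.mem_graph b, T.mem_graph ⟨R b, hb⟩⟩
  · rintro ⟨y, hxy, hyz⟩
    obtain ⟨a, rfl, rfl⟩ := R.mem_graph_iff.1 hxy
    obtain ⟨⟨_, hb⟩, rfl, hz⟩ := T.mem_graph_iff.1 hyz
    exact (LinearPMap.mem_graph_iff _).2 ⟨⟨a, ⟨a, hb, rfl⟩, a.2⟩, rfl, hz⟩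

theorem mem_kernel {T : H →ₗ.[ℂ] H} {x : H} : x ∈ T.kernel ↔ (x, 0) ∈ T.graph := by
  rw [LinearPMap.mem_graph_iff]
  exact ⟨fun ⟨a, ha, hax⟩ => ⟨a, hax, ha⟩, fun ⟨a, hax, ha⟩ => ⟨a, ha, hax⟩⟩

theorem mem_graph_projAlong {U N : Submodule ℂ H} (h : Disjoint U N) {x y : H} :
    (x, y) ∈ (LinearPMap.projAlong U N).graph ↔ y ∈ U ∧ x - y ∈ N := by
  rw [LinearPMap.projAlong, Submodule.toLinearPMap_graph_eq]
  · constructor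
    · rintro ⟨⟨a, b⟩, ⟨ha, hb⟩, hab⟩
      obtain ⟨rfl, rfl⟩ := Prod.mk.inj hab
      exact ⟨ha, by simpa using hb⟩
    · rintro ⟨hy, hxy⟩
      exact ⟨(y, x - y), ⟨hy, hxy⟩, by simp⟩
  · rintro _ ⟨⟨a, b⟩, ⟨ha, hb⟩, rfl⟩ (hab : a + b = 0)
    refine Submodule.disjoint_def.1 h a ha ?_
    rw [eq_neg_of_add_eq_zero_left hab]
    exact N.neg_mem hb

end Operations

section Adjoint

variable {𝕜 E F : Type*} [RCLike 𝕜] [NormedAddCommGroup E] [InnerProductSpace 𝕜 E]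
  [CompleteSpace E] [NormedAddCommGroup F] [InnerProductSpace 𝕜 F] {T : E →ₗ.[𝕜] F}

theorem mem_graph_adjoint (hT : Dense (T.domain : Set E)) {x : F} {y : E} :
    (x, y) ∈ T.adjoint.graph ↔ ∀ a b, (a, b) ∈ T.graph → inner 𝕜 b x = inner 𝕜 a y := by
  simp only [LinearPMap.adjoint_graph_eq_graph_adjoint hT, Submodule.mem_adjoint_iff, sub_eq_zero]

theorem mem_graph_adjoint_iff_forall_domain (hT : Dense (T.domain : Set E)) {x : F} {y : E} :
    (x, y) ∈ T.adjoint.graph ↔ ∀ f : T.domain, inner 𝕜 (T f) x = inner 𝕜 (f : E) y := by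
  rw [mem_graph_adjoint hT]
  refine ⟨fun h f => h _ _ (T.mem_graph f), fun h a b hab => ?_⟩
  obtain ⟨f, rfl, rfl⟩ := T.mem_graph_iff.1 hab
  exact h f

theorem inner_eq_inner_of_isSelfAdjoint {R : E →ₗ.[𝕜] E} (hR : IsSelfAdjoint R) {a b x y : E}
    (hab : (a, b) ∈ R.graph) (hxy : (x, y) ∈ R.graph) : inner 𝕜 b x = inner 𝕜 a y := by
  rw [← LinearPMap.isSelfAdjoint_def.1 hR] at hxy
  exact (mem_graph_adjoint hR.dense_domain).1 hxy a b hab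

end Adjoint

section Range

variable {𝕜 E E' F : Type*} [RCLike 𝕜]
  [NormedAddCommGroup E] [InnerProductSpace 𝕜 E] [CompleteSpace E]
  [NormedAddCommGroup E'] [InnerProductSpace 𝕜 E'] [CompleteSpace E']
  [NormedAddCommGroup F] [InnerProductSpace 𝕜 F] [CompleteSpace F]

theorem exists_sub_apply_mem_orthogonal (A : E →L[𝕜] F) (U : Submodule 𝕜 F) (x : F) (c : ℝ)
    (h : ∀ y ∈ U, ‖inner 𝕜 x y‖ ≤ c * ‖A.adjoint y‖) : ∃ w, x - A w ∈ Uᗮ := by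
  let D : U →ₗ[𝕜] E := (A.adjoint : F →ₗ[𝕜] E) ∘ₗ U.subtype
  obtain ⟨s, hs⟩ := D.rangeRestrict.exists_rightInverse_of_surjective D.range_rangeRestrict
  have hDs (z : D.range) : A.adjoint (s z) = z := congrArg Subtype.val (LinearMap.congr_fun hs z)
  -- By `h`, `⟪x, y⟫` depends only on `A.adjoint y`, so any section `s` will do.
  have hsD (y : U) : inner 𝕜 x (s (D.rangeRestrict y)) = inner 𝕜 x y := by
    rw [← sub_eq_zero, ← inner_sub_right, ← norm_le_zero_iff]
    refine (h _ (s _ - y).2).trans_eq ?_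
    rw [Submodule.coe_sub, map_sub, hDs]
    simp [D]
  let φ : StrongDual 𝕜 D.range :=
    (innerₛₗ 𝕜 x ∘ₗ U.subtype ∘ₗ s).mkContinuous c fun z =>
      (h (s z) (s z).2).trans_eq (by rw [hDs, Submodule.coe_norm])
  obtain ⟨ψ, hψ, -⟩ := exists_extension_norm_eq _ φ
  refine ⟨(InnerProductSpace.toDual 𝕜 E).symm ψ, (Submodule.mem_orthogonal' _ _).2 fun y hy => ?_⟩
  rw [inner_sub_left, sub_eq_zero, ← ContinuousLinearMap.adjoint_inner_right,
    InnerProductSpace.toDual_symm_apply]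
  exact (hsD ⟨y, hy⟩).symm.trans (hψ (D.rangeRestrict ⟨y, hy⟩)).symm

theorem range_le_range_of_norm_adjoint_le {A : E →L[𝕜] F} {B : E' →L[𝕜] F}
    (h : ∀ y, ‖A.adjoint y‖ ≤ ‖B.adjoint y‖) : A.range ≤ B.range := by
  rintro _ ⟨x, rfl⟩
  obtain ⟨w, hw⟩ := exists_sub_apply_mem_orthogonal B ⊤ (A x) ‖x‖ fun y _ => calc
    ‖inner 𝕜 (A x) y‖ = ‖inner 𝕜 x (A.adjoint y)‖ := by rw [ContinuousLinearMap.adjoint_inner_right]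
    _ ≤ ‖x‖ * ‖A.adjoint y‖ := norm_inner_le_norm _ _
    _ ≤ ‖x‖ * ‖B.adjoint y‖ := by gcongr; exact h y
  rw [Submodule.top_orthogonal_eq_bot, Submodule.mem_bot, sub_eq_zero] at hw
  exact ⟨w, hw.symm⟩

theorem range_eq_range_of_comp_adjoint_eq {A : E →L[𝕜] F} {B : E' →L[𝕜] F}
    (h : A ∘L A.adjoint = B ∘L B.adjoint) : A.range = B.range := by
  have hnorm (y : F) : ‖A.adjoint y‖ = ‖B.adjoint y‖ := by
    rw [← sq_eq_sq₀ (norm_nonneg _) (norm_nonneg _),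
      ContinuousLinearMap.apply_norm_sq_eq_inner_adjoint_right,
      ContinuousLinearMap.apply_norm_sq_eq_inner_adjoint_right,
      ContinuousLinearMap.adjoint_adjoint, ContinuousLinearMap.adjoint_adjoint, h]
  exact le_antisymm (range_le_range_of_norm_adjoint_le fun y => (hnorm y).le)
    (range_le_range_of_norm_adjoint_le fun y => (hnorm y).ge)

end Range

section MoorePenrose

variable {𝕜 E F : Type*} [RCLike 𝕜] [NormedAddCommGroup E] [InnerProductSpace 𝕜 E]
  [NormedAddCommGroup F] [InnerProductSpace 𝕜 F]

/-- The Moore–Penrose inverse of a bounded operator `A`, an unbounded operator with domain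
`ran A + (ran A)ᗮ`. It is encoded by its graph: `x` is mapped to the solution `y ∈ (ker A)ᗮ` of the
least squares problem `x - A y ∈ (ran A)ᗮ`. -/
def pinv (A : E →L[𝕜] F) : F →ₗ.[𝕜] E :=
  (A.kerᗮ.comap (LinearMap.snd 𝕜 F E) ⊓
    A.rangeᗮ.comap (LinearMap.fst 𝕜 F E - (A : E →ₗ[𝕜] F) ∘ₗ LinearMap.snd 𝕜 F E)).toLinearPMap

theorem mem_graph_pinv {A : E →L[𝕜] F} {x : F} {y : E} :
    (x, y) ∈ (pinv A).graph ↔ y ∈ A.kerᗮ ∧ x - A y ∈ A.rangeᗮ := by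
  rw [pinv, Submodule.toLinearPMap_graph_eq]
  · rfl
  · rintro ⟨x, y⟩ ⟨hy, hxy⟩ (rfl : x = 0)
    have hAy : A y = 0 := Submodule.disjoint_def.1 A.range.orthogonal_disjoint _ ⟨y, rfl⟩ (by
      simpa using hxy)
    exact Submodule.disjoint_def.1 A.ker.orthogonal_disjoint y hAy hy

theorem domain_pinv [CompleteSpace E] (A : E →L[𝕜] F) :
    (pinv A).domain = A.range ⊔ A.rangeᗮ := by
  have : CompleteSpace A.ker := A.isClosed_ker.completeSpace_coe
  ext x
  rw [LinearPMap.mem_domain_iff]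
  simp only [mem_graph_pinv]
  constructor
  · rintro ⟨y, -, hxy⟩
    exact Submodule.mem_sup.2 ⟨A y, ⟨y, rfl⟩, x - A y, hxy, add_sub_cancel _ _⟩
  · intro hx
    obtain ⟨_, ⟨z, rfl⟩, n, hn, rfl⟩ := Submodule.mem_sup.1 hx
    obtain ⟨k, hk, y, hy, rfl⟩ := A.ker.exists_add_mem_mem_orthogonal z
    refine ⟨y, hy, ?_⟩
    simpa [show A k = 0 from hk] using hn

theorem dense_domain_pinv [CompleteSpace E] [CompleteSpace F] (A : E →L[𝕜] F) :
    Dense ((pinv A).domain : Set F) := by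
  rw [Submodule.dense_iff_topologicalClosure_eq_top, Submodule.topologicalClosure_eq_top_iff,
    domain_pinv, ← Submodule.inf_orthogonal, Submodule.inf_orthogonal_eq_bot]

theorem adjoint_pinv [CompleteSpace E] [CompleteSpace F] (A : E →L[𝕜] F) :
    (pinv A).adjoint = pinv A.adjoint := by
  have : CompleteSpace A.ker := A.isClosed_ker.completeSpace_coe
  refine LinearPMap.eq_of_eq_graph (Submodule.ext fun ⟨x, y⟩ => ?_)
  rw [mem_graph_adjoint (dense_domain_pinv A), mem_graph_pinv, ← A.orthogonal_range,
    A.adjoint.orthogonal_range, A.adjoint_adjoint]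
  simp only [mem_graph_pinv]
  constructor
  · intro h
    refine ⟨fun n hn => ?_, ?_⟩
    · rw [← h n 0 ⟨zero_mem _, by simpa using hn⟩, inner_zero_left]
    · rw [← A.ker.orthogonal_orthogonal]
      intro z hz
      rw [inner_sub_right, h (A z) z ⟨hz, by simp⟩, A.adjoint_inner_right, sub_self]
  · rintro ⟨hy, hxy⟩ a b ⟨hb, hab⟩
    have hay : inner 𝕜 (a - A b) y = 0 := hy _ hab
    have hbx : inner 𝕜 b (x - A.adjoint y) = 0 := Submodule.inner_left_of_mem_orthogonal hxy hb
    rw [inner_sub_left, sub_eq_zero] at hay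
    rw [inner_sub_right, sub_eq_zero] at hbx
    rw [hay, hbx, A.adjoint_inner_right]

variable [CompleteSpace E] {G : E →L[𝕜] E}

theorem orthogonal_range_of_isSelfAdjoint (hG : IsSelfAdjoint G) : G.rangeᗮ = G.ker := by
  rw [G.orthogonal_range, hG.adjoint_eq]

theorem apply_mem_orthogonal_ker (hG : IsSelfAdjoint G) (x : E) : G x ∈ G.kerᗮ := by
  rw [← orthogonal_range_of_isSelfAdjoint hG]
  exact Submodule.le_orthogonal_orthogonal _ ⟨x, rfl⟩

theorem mem_graph_pinv_of_isSelfAdjoint (hG : IsSelfAdjoint G) {x y : E} :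
    (x, y) ∈ (pinv G).graph ↔ y ∈ G.kerᗮ ∧ x - G y ∈ G.ker := by
  rw [mem_graph_pinv, orthogonal_range_of_isSelfAdjoint hG]

theorem mem_graph_pinv_of_ker_eq_bot (hG : IsSelfAdjoint G) (hker : G.ker = ⊥) {x y : E} :
    (x, y) ∈ (pinv G).graph ↔ G y = x := by
  rw [mem_graph_pinv_of_isSelfAdjoint hG, hker, Submodule.bot_orthogonal_eq_top,
    Submodule.mem_bot, sub_eq_zero, eq_comm]
  exact and_iff_right Submodule.mem_top

theorem mem_graph_inverse_domRestrict_pinv (hG : IsSelfAdjoint G) (hker : G.ker = ⊥)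
    {U : Submodule 𝕜 E} {x y : E} :
    (x, y) ∈ ((pinv G).domRestrict U).inverse.graph ↔ y ∈ U ∧ G x = y := by
  have hinj : LinearMap.ker ((pinv G).domRestrict U).toFun = ⊥ := by
    refine LinearMap.ker_eq_bot'.2 fun f hf => Subtype.ext ?_
    have hf0 := (mem_graph_domRestrict.1 (((pinv G).domRestrict U).mem_graph f)).2
    rw [mem_graph_pinv_of_ker_eq_bot hG hker] at hf0
    exact hf0.symm.trans ((congrArg G hf).trans (map_zero G))
  rw [mem_graph_inverse hinj, mem_graph_domRestrict, mem_graph_pinv_of_ker_eq_bot hG hker]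

theorem isSelfAdjoint_pinv (hG : IsSelfAdjoint G) : IsSelfAdjoint (pinv G) := by
  rw [LinearPMap.isSelfAdjoint_def, adjoint_pinv, hG.adjoint_eq]

theorem inner_pinv_nonneg (hG : G.IsPositive) (f : (pinv G).domain) :
    0 ≤ RCLike.re (inner 𝕜 (f : E) (pinv G f)) := by
  obtain ⟨hker, hsub⟩ :=
    (mem_graph_pinv_of_isSelfAdjoint hG.isSelfAdjoint).1 ((pinv G).mem_graph f)
  have h : inner 𝕜 (f - G (pinv G f)) (pinv G f) = 0 := hker _ hsub
  rw [inner_sub_left, sub_eq_zero] at h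
  rw [h]
  exact hG.re_inner_nonneg_left _

end MoorePenrose

section SquareRoot

variable {H : Type*} [NormedAddCommGroup H] [InnerProductSpace ℂ H] [CompleteSpace H]

theorem ker_mul_self {B : H →L[ℂ] H} (hB : IsSelfAdjoint B) : (B * B).ker = B.ker := by
  have h := B.ker_adjoint_comp_self
  rwa [hB.adjoint_eq] at h

theorem mulOp_pinv_self {B : H →L[ℂ] H} (hB : IsSelfAdjoint B) :
    (pinv B).mulOp (pinv B) = pinv (B * B) := by
  have hBB : IsSelfAdjoint (B * B) := sq B ▸ hB.pow 2
  refine LinearPMap.eq_of_eq_graph (Submodule.ext fun ⟨x, z⟩ => ?_)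
  simp only [mem_graph_mulOp, mem_graph_pinv_of_isSelfAdjoint hB,
    mem_graph_pinv_of_isSelfAdjoint hBB, ker_mul_self hB]
  constructor
  · rintro ⟨y, ⟨hy, hxy⟩, hz, hyz⟩
    have h : y - B z = 0 := Submodule.disjoint_def.1 B.ker.orthogonal_disjoint _ hyz
      (sub_mem hy (apply_mem_orthogonal_ker hB z))
    rw [sub_eq_zero.1 h] at hxy
    exact ⟨hz, hxy⟩
  · rintro ⟨hz, hxz⟩
    exact ⟨B z, ⟨apply_mem_orthogonal_ker hB z, hxz⟩, hz, by simp⟩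

theorem isNonnegSqrt_pinv {B : H →L[ℂ] H} (hB : B.IsPositive) :
    (pinv (B * B)).IsNonnegSqrt (pinv B) :=
  ⟨isSelfAdjoint_pinv hB.isSelfAdjoint, inner_pinv_nonneg hB, mulOp_pinv_self hB.isSelfAdjoint⟩

variable {R : H →ₗ.[ℂ] H}

theorem kernel_mulOp_self (hR : IsSelfAdjoint R) : (R.mulOp R).kernel = R.kernel := by
  ext x
  rw [mem_kernel, mem_graph_mulOp, mem_kernel]
  constructor
  · rintro ⟨y, hxy, hy⟩
    have h : inner ℂ y y = inner ℂ x (0 : H) := inner_eq_inner_of_isSelfAdjoint hR hxy hy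
    rw [inner_zero_right, inner_self_eq_zero] at h
    rwa [h] at hxy
  · exact fun hx => ⟨0, hx, R.graph.zero_mem⟩

theorem mem_orthogonal_kernel (hR : IsSelfAdjoint R) {x y : H} (hxy : (x, y) ∈ R.graph) :
    y ∈ R.kernelᗮ := fun n hn => by
  rw [← inner_eq_inner_of_isSelfAdjoint hR (mem_kernel.1 hn) hxy, inner_zero_left]

theorem kernel_pinv {G : H →L[ℂ] H} (hG : IsSelfAdjoint G) : (pinv G).kernel = G.ker := by
  ext x
  simp [mem_kernel, mem_graph_pinv_of_isSelfAdjoint hG]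

variable {G : H →L[ℂ] H}

theorem apply_starProjection_mem_graph_pinv (hG : IsSelfAdjoint G) (x : H) :
    (G x, G.kerᗮ.starProjection x) ∈ (pinv G).graph := by
  have : CompleteSpace G.ker := G.isClosed_ker.completeSpace_coe
  rw [mem_graph_pinv_of_isSelfAdjoint hG]
  refine ⟨Submodule.starProjection_apply_mem _ x, ?_⟩
  have h : x - G.kerᗮ.starProjection x ∈ G.kerᗮᗮ := Submodule.sub_starProjection_mem_orthogonal x
  rw [Submodule.orthogonal_orthogonal, LinearMap.mem_ker] at h
  rw [← map_sub]
  exact (congrArg G h).trans (map_zero G)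

/-- The map `B` is `R ∘ G`: it is everywhere defined because `G x` lies in the domain of `R²`. -/
theorem exists_linearMap_mem_graph (hG : IsSelfAdjoint G) (hR : R.mulOp R = pinv G) :
    ∃ B : H →ₗ[ℂ] H, ∀ x, (G x, B x) ∈ R.graph ∧ (B x, G.kerᗮ.starProjection x) ∈ R.graph := by
  have hRR (x : H) : ∃ y, (G x, y) ∈ R.graph ∧ (y, G.kerᗮ.starProjection x) ∈ R.graph :=
    mem_graph_mulOp.1 (hR ▸ apply_starProjection_mem_graph_pinv hG x)
  have hdom (x : H) : G x ∈ R.domain := LinearPMap.mem_domain_of_mem_graph (hRR x).choose_spec.1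
  refine ⟨R.toFun ∘ₗ (G : H →ₗ[ℂ] H).codRestrict R.domain hdom, fun x => ?_⟩
  have hGB := R.mem_graph ⟨G x, hdom x⟩
  obtain ⟨y, hGy, hyP⟩ := hRR x
  rw [R.mem_graph_snd_inj hGy hGB rfl] at hyP
  exact ⟨hGB, hyP⟩

theorem exists_isPositive_mul_self_eq (hG : IsSelfAdjoint G) (hR : (pinv G).IsNonnegSqrt R) :
    ∃ B : H →L[ℂ] H, B.IsPositive ∧ B * B = G ∧ ∀ y ∈ G.kerᗮ, (B y, y) ∈ R.graph := by
  obtain ⟨hRsa, hRnonneg, hRR⟩ := hR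
  have hker : R.kernel = G.ker := by rw [← kernel_mulOp_self hRsa, hRR, kernel_pinv hG]
  obtain ⟨B, hB⟩ := exists_linearMap_mem_graph hG hRR
  have hB_mem (x : H) : B x ∈ G.kerᗮ := hker ▸ mem_orthogonal_kernel hRsa (hB x).1
  have hBR {y : H} (hy : y ∈ G.kerᗮ) : (B y, y) ∈ R.graph := by
    have h := (hB y).2
    rwa [Submodule.starProjection_eq_self_iff.2 hy] at h
  have hinner (x y : H) : inner ℂ (G.kerᗮ.starProjection x) (B y) = inner ℂ x (B y) := by
    rw [Submodule.inner_starProjection_left_eq_right,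
      Submodule.starProjection_eq_self_iff.2 (hB_mem y)]
  have hinner' (x y : H) : inner ℂ (B x) (G.kerᗮ.starProjection y) = inner ℂ (B x) y := by
    rw [← inner_conj_symm, hinner, inner_conj_symm]
  have hsymm : B.IsSymmetric := fun x y => by
    rw [← hinner', ← hinner, inner_eq_inner_of_isSelfAdjoint hRsa (hB x).2 (hB y).2]
  have hpos (x : H) : 0 ≤ (inner ℂ (B x) x).re := by
    obtain ⟨f, hf, hRf⟩ := R.mem_graph_iff.1 (hB x).2
    have h := hRnonneg f
    rwa [hf, hRf, hinner'] at h
  refine ⟨⟨B, hsymm.continuous⟩, ContinuousLinearMap.isPositive_def.2 ⟨hsymm, hpos⟩, ?_,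
    fun y => hBR⟩
  ext x
  have hdiff : B (B x) - G x ∈ G.ker := by
    rw [← hker, mem_kernel]
    simpa using sub_mem (hBR (hB_mem x)) (hB x).1
  exact sub_eq_zero.1 (Submodule.disjoint_def.1 G.ker.orthogonal_disjoint _ hdiff
    (sub_mem (hB_mem _) (apply_mem_orthogonal_ker hG x)))

theorem exists_isPositive_mul_self_eq_and_eq_pinv (hG : IsSelfAdjoint G)
    (hR : (pinv G).IsNonnegSqrt R) : ∃ B : H →L[ℂ] H, B.IsPositive ∧ B * B = G ∧ R = pinv B := by
  obtain ⟨B, hB, rfl, hBR⟩ := exists_isPositive_mul_self_eq hG hR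
  have hker : R.kernel = B.ker := by
    rw [← kernel_mulOp_self hR.1, hR.2.2, kernel_pinv hG, ker_mul_self hB.isSelfAdjoint]
  rw [ker_mul_self hB.isSelfAdjoint] at hBR
  refine ⟨B, hB, rfl, LinearPMap.eq_of_eq_graph (Submodule.ext fun ⟨x, y⟩ => ?_)⟩
  rw [mem_graph_pinv_of_isSelfAdjoint hB.isSelfAdjoint, ← hker, mem_kernel]
  constructor
  · intro hxy
    have hy : y ∈ R.kernelᗮ := mem_orthogonal_kernel hR.1 hxy
    exact ⟨hy, by simpa using sub_mem hxy (hBR y (hker ▸ hy))⟩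
  · rintro ⟨hy, hxy⟩
    simpa using add_mem hxy (hBR y (hker ▸ hy))

theorem isPositive_sqrt (G : H →L[ℂ] H) : (CFC.sqrt G).IsPositive :=
  (ContinuousLinearMap.nonneg_iff_isPositive _).1 (CFC.sqrt_nonneg G)

theorem sqrt_mul_sqrt (hG : G.IsPositive) : CFC.sqrt G * CFC.sqrt G = G :=
  CFC.sqrt_mul_sqrt_self G ((ContinuousLinearMap.nonneg_iff_isPositive G).2 hG)

theorem sqrtOp_pinv (hG : G.IsPositive) : (pinv G).sqrtOp = pinv (CFC.sqrt G) := by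
  have hex : ∃ R, (pinv G).IsNonnegSqrt R :=
    ⟨_, by simpa only [sqrt_mul_sqrt hG] using isNonnegSqrt_pinv (isPositive_sqrt G)⟩
  obtain ⟨B, hB, hBB, hR⟩ :=
    exists_isPositive_mul_self_eq_and_eq_pinv hG.isSelfAdjoint hex.choose_spec
  rw [LinearPMap.sqrtOp, dif_pos hex, hR,
    CFC.sqrt_unique hBB ((ContinuousLinearMap.nonneg_iff_isPositive B).2 hB)]

theorem isNonnegSqrt_sqrtOp_pinv (hG : G.IsPositive) :
    (pinv G).IsNonnegSqrt (pinv G).sqrtOp := by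
  simpa only [sqrtOp_pinv hG, sqrt_mul_sqrt hG] using isNonnegSqrt_pinv (isPositive_sqrt G)

variable {K : Type*} [NormedAddCommGroup K] [InnerProductSpace ℂ K] [CompleteSpace K]

theorem range_sqrt_comp_adjoint_self (T : K →L[ℂ] H) :
    (CFC.sqrt (T ∘L T.adjoint)).range = T.range := by
  refine range_eq_range_of_comp_adjoint_eq ?_
  rw [(isPositive_sqrt _).isSelfAdjoint.adjoint_eq]
  exact sqrt_mul_sqrt T.isPositive_self_comp_adjoint

theorem domain_sqrtOp_pinv_comp_adjoint_self (T : K →L[ℂ] H) :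
    (pinv (T ∘L T.adjoint)).sqrtOp.domain = T.range ⊔ T.rangeᗮ := by
  rw [sqrtOp_pinv T.isPositive_self_comp_adjoint, domain_pinv, range_sqrt_comp_adjoint_self]

end SquareRoot

end UnboundedOperator

namespace NonnegForm

open UnboundedOperator

section Energy

variable {H : Type*} [NormedAddCommGroup H] [InnerProductSpace ℂ H] {q : NonnegForm H}

/-- The domain of a non-negative form `q`, as a semi-inner product space with the semi-inner
product `q`. It is a type synonym, since `q.domain` already carries the norm of `H`. -/
def EnergyDomain (q : NonnegForm H) : Type _ := q.domain

instance (q : NonnegForm H) : AddCommGroup q.EnergyDomain := inferInstanceAs (AddCommGroup q.domain)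

instance (q : NonnegForm H) : Module ℂ q.EnergyDomain := inferInstanceAs (Module ℂ q.domain)

instance (q : NonnegForm H) : PreInnerProductSpace.Core ℂ q.EnergyDomain := q.core

instance (q : NonnegForm H) : SeminormedAddCommGroup q.EnergyDomain :=
  InnerProductSpace.Core.toSeminormedAddCommGroup (𝕜 := ℂ)

instance (q : NonnegForm H) : InnerProductSpace ℂ q.EnergyDomain :=
  InnerProductSpace.ofCore inferInstance

/-- The identity map from the domain of a form to its type synonym `EnergyDomain`. -/
def toEnergyDomain (q : NonnegForm H) : q.domain ≃ₗ[ℂ] q.EnergyDomain := LinearEquiv.refl ℂ q.domain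

theorem norm_form_le (f g : q.domain) : ‖q.form f g‖ ≤ √(q.quad f) * √(q.quad g) :=
  norm_inner_le_norm (𝕜 := ℂ) (q.toEnergyDomain f) (q.toEnergyDomain g)

/-- A completion of a non-negative form `q` on `H` in its energy norm: an inner product space `K`
(meant to be complete) in which the domain of `q` embeds densely and isometrically, such that the
inclusion of the domain in `H` extends continuously to `K`. The extension need not be injective:
that would amount to closability of `q`. -/
structure EnergyCompletion (q : NonnegForm H) (K : Type*) [NormedAddCommGroup K]
    [InnerProductSpace ℂ K] where
  /-- the embedding of the domain of the form -/
  emb : q.domain →ₗ[ℂ] K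
  /-- the extension of the inclusion of the domain in `H` -/
  incl : K →L[ℂ] H
  denseRange_emb : DenseRange emb
  inner_emb : ∀ f g, inner ℂ (emb f) (emb g) = q.form f g
  incl_emb : ∀ f, incl (emb f) = f

theorem norm_le_inv_sqrt_mul_sqrt_quad {ε : ℝ} (hε : 0 < ε) {f : q.domain}
    (h : ε * ‖(f : H)‖ ^ 2 ≤ q.quad f) : ‖(f : H)‖ ≤ (√ε)⁻¹ * √(q.quad f) := by
  rw [← Real.sqrt_inv, ← Real.sqrt_mul (inv_nonneg.2 hε.le)]
  exact Real.le_sqrt_of_sq_le ((le_inv_mul_iff₀ hε).2 h)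

/-- The Hausdorff completion of the domain of a form that is bounded below by a positive
constant. -/
def energyCompletion [CompleteSpace H] (q : NonnegForm H) {ε : ℝ} (hε : 0 < ε)
    (h : ∀ f : q.domain, ε * ‖(f : H)‖ ^ 2 ≤ q.quad f) :
    q.EnergyCompletion (UniformSpace.Completion q.EnergyDomain) :=
  let i : q.EnergyDomain →L[ℂ] H :=
    (q.domain.subtype ∘ₗ q.toEnergyDomain.symm.toLinearMap).mkContinuous (√ε)⁻¹ fun f =>
      norm_le_inv_sqrt_mul_sqrt_quad hε (h (q.toEnergyDomain.symm f))
  { emb := UniformSpace.Completion.toComplₗᵢ.toLinearMap ∘ₗ q.toEnergyDomain.toLinearMap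
    incl := i.extend UniformSpace.Completion.toComplL
    denseRange_emb := UniformSpace.Completion.denseRange_coe.comp
      q.toEnergyDomain.surjective.denseRange (UniformSpace.Completion.continuous_coe _)
    inner_emb := fun f g =>
      UniformSpace.Completion.inner_coe (q.toEnergyDomain f) (q.toEnergyDomain g)
    incl_emb := fun f => i.extend_eq (e := UniformSpace.Completion.toComplL)
      UniformSpace.Completion.denseRange_coe (UniformSpace.Completion.isUniformInducing_coe _)
      (q.toEnergyDomain f) }

theorem mem_graph_toOperator (hq : Dense (q.domain : Set H)) {x y : H} :
    (x, y) ∈ q.toOperator.graph ↔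
      ∃ hx : x ∈ q.domain, ∀ g : q.domain, q.form g ⟨x, hx⟩ = inner ℂ (g : H) y := by
  rw [toOperator, Submodule.toLinearPMap_graph_eq]
  · rfl
  · rintro ⟨x, y⟩ ⟨hx, h⟩ (rfl : x = 0)
    refine hq.eq_zero_of_inner_right ℂ fun g hg => ?_
    rw [← h ⟨g, hg⟩]
    exact map_zero (q.form ⟨g, hg⟩)

theorem domain_le_closureDomain : q.domain ≤ q.closureDomain :=
  fun f hf => ⟨_, q.approx_const ⟨f, hf⟩⟩

end Energy

namespace EnergyCompletion

variable {H K : Type*} [NormedAddCommGroup H] [InnerProductSpace ℂ H] [NormedAddCommGroup K]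
  [InnerProductSpace ℂ K] {q : NonnegForm H} (m : q.EnergyCompletion K)

theorem quad_eq (f : q.domain) : q.quad f = ‖m.emb f‖ ^ 2 := by
  rw [quad, ← m.inner_emb, ← inner_self_eq_norm_sq (𝕜 := ℂ), RCLike.re_eq_complex_re]

theorem approx_of_tendsto {u : ℕ → q.domain} {k : K}
    (h : Tendsto (fun n => m.emb (u n)) atTop (𝓝 k)) : q.Approx u (m.incl k) := by
  constructor
  · simpa only [Function.comp_def, m.incl_emb] using (m.incl.continuous.tendsto k).comp h
  · simp only [m.quad_eq, map_sub, ← dist_eq_norm]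
    simpa using (cauchySeq_iff_tendsto_dist_atTop_0.1 h.cauchySeq).pow 2

theorem exists_tendsto_of_approx [CompleteSpace K] {u : ℕ → q.domain} {f : H}
    (h : q.Approx u f) : ∃ k, Tendsto (fun n => m.emb (u n)) atTop (𝓝 k) ∧ m.incl k = f := by
  have hcauchy : CauchySeq fun n => m.emb (u n) := by
    rw [cauchySeq_iff_tendsto_dist_atTop_0]
    have hsqrt := h.2.sqrt
    simp only [m.quad_eq, map_sub, ← dist_eq_norm, Real.sqrt_zero, Real.sqrt_sq dist_nonneg]
      at hsqrt
    exact hsqrt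
  obtain ⟨k, hk⟩ := cauchySeq_tendsto_of_complete hcauchy
  exact ⟨k, hk, tendsto_nhds_unique (m.approx_of_tendsto hk).1 h.1⟩

theorem exists_seq_tendsto (k : K) :
    ∃ u : ℕ → q.domain, Tendsto (fun n => m.emb (u n)) atTop (𝓝 k) := by
  obtain ⟨x, hx, hk⟩ := mem_closure_iff_seq_limit.1 (m.denseRange_emb k)
  choose u hu using hx
  exact ⟨u, by simpa only [hu] using hk⟩

theorem closureDomain_eq [CompleteSpace K] : q.closureDomain = m.incl.range := by
  ext f
  constructor
  · rintro ⟨u, hu⟩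
    obtain ⟨k, -, hk⟩ := m.exists_tendsto_of_approx hu
    exact ⟨k, hk⟩
  · rintro ⟨k, rfl⟩
    obtain ⟨u, hu⟩ := m.exists_seq_tendsto k
    exact ⟨u, m.approx_of_tendsto hu⟩

theorem isClosable [CompleteSpace K] (h : Function.Injective m.incl) : q.IsClosable := by
  intro u hu hu'
  obtain ⟨k, hk, hk0⟩ := m.exists_tendsto_of_approx ⟨tendsto_zero_iff_norm_tendsto_zero.2 hu, hu'⟩
  obtain rfl : k = 0 := h (hk0.trans (map_zero _).symm)
  simpa [m.quad_eq] using hk.norm.pow 2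

theorem closureVal_eq (hq : q.IsClosable) {f g : q.closureDomain} {k l : K} (hk : m.incl k = f)
    (hl : m.incl l = g) : q.closureVal f g = inner ℂ k l := by
  obtain ⟨u, hu⟩ := m.exists_seq_tendsto k
  obtain ⟨v, hv⟩ := m.exists_seq_tendsto l
  refine tendsto_nhds_unique (q.tendsto_closureVal hq f g (hk ▸ m.approx_of_tendsto hu)
    (hl ▸ m.approx_of_tendsto hv)) ?_
  simpa only [m.inner_emb] using hu.inner (𝕜 := ℂ) hv

theorem mul_norm_incl_sq_le {ε : ℝ} (h : ∀ f : q.domain, ε * ‖(f : H)‖ ^ 2 ≤ q.quad f) (k : K) :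
    ε * ‖m.incl k‖ ^ 2 ≤ ‖k‖ ^ 2 := by
  refine m.denseRange_emb.induction_on (p := fun k => ε * ‖m.incl k‖ ^ 2 ≤ ‖k‖ ^ 2) k
    (isClosed_le (by fun_prop) (by fun_prop)) fun f => ?_
  rw [m.incl_emb, ← m.quad_eq]
  exact h f

variable [CompleteSpace H] [CompleteSpace K]

/-- The Green operator `ι ι*` of a form, where `ι` is the inclusion of the energy completion in `H`:
the bounded inverse of the operator of the closure of the form. -/
def green : H →L[ℂ] H := m.incl ∘L m.incl.adjoint

theorem isPositive_green : m.green.IsPositive := m.incl.isPositive_self_comp_adjoint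

theorem ker_green (hd : Dense (q.domain : Set H)) : m.green.ker = ⊥ := by
  have hdense : DenseRange m.incl := hd.mono fun f hf => ⟨m.emb ⟨f, hf⟩, m.incl_emb _⟩
  rw [green, m.incl.ker_self_comp_adjoint, ← m.incl.orthogonal_range,
    ← Submodule.topologicalClosure_eq_top_iff, ← Submodule.dense_iff_topologicalClosure_eq_top]
  exact hdense

theorem mem_graph_pinv_green (hd : Dense (q.domain : Set H)) {x y : H} :
    (x, y) ∈ (pinv m.green).graph ↔ m.green y = x :=
  mem_graph_pinv_of_ker_eq_bot m.isPositive_green.isSelfAdjoint (m.ker_green hd)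

theorem isStrictlyPositiveSymmetric_pinv_green (hd : Dense (q.domain : Set H)) {ε : ℝ} (hε : 0 < ε)
    (h : ∀ f : q.domain, ε * ‖(f : H)‖ ^ 2 ≤ q.quad f) :
    (pinv m.green).IsStrictlyPositiveSymmetric := by
  have hsa := isSelfAdjoint_pinv m.isPositive_green.isSelfAdjoint
  refine ⟨hsa.dense_domain, fun f g => inner_eq_inner_of_isSelfAdjoint hsa
    ((pinv m.green).mem_graph f) ((pinv m.green).mem_graph g), ε, hε, fun f => ?_⟩
  set y := pinv m.green f
  have hy : m.green y = f := (m.mem_graph_pinv_green hd).1 ((pinv m.green).mem_graph f)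
  calc ε * ‖(f : H)‖ ^ 2 = ε * ‖m.incl (m.incl.adjoint y)‖ ^ 2 := by rw [← hy]; rfl
    _ ≤ ‖m.incl.adjoint y‖ ^ 2 := m.mul_norm_incl_sq_le h _
    _ = (inner ℂ (f : H) y).re := by
      rw [← inner_self_eq_norm_sq (𝕜 := ℂ), m.incl.adjoint_inner_right, ← hy]
      rfl

/-- The inverse square root of the operator of the closure of a form: `D(q̄) = ran (ι ι*)^{1/2}`. -/
def sqrtGreen : H →L[ℂ] H := CFC.sqrt m.green

theorem isPositive_sqrtGreen : m.sqrtGreen.IsPositive := isPositive_sqrt m.green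

theorem sqrtGreen_mul_self : m.sqrtGreen * m.sqrtGreen = m.green := sqrt_mul_sqrt m.isPositive_green

theorem range_sqrtGreen : m.sqrtGreen.range = m.incl.range := range_sqrt_comp_adjoint_self m.incl

theorem ker_sqrtGreen (hd : Dense (q.domain : Set H)) : m.sqrtGreen.ker = ⊥ := by
  rw [← ker_mul_self m.isPositive_sqrtGreen.isSelfAdjoint, m.sqrtGreen_mul_self, m.ker_green hd]

theorem sqrtOp_pinv_green : (pinv m.green).sqrtOp = pinv m.sqrtGreen :=
  sqrtOp_pinv m.isPositive_green

theorem mem_graph_pinv_sqrtGreen (hd : Dense (q.domain : Set H)) {x y : H} :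
    (x, y) ∈ (pinv m.sqrtGreen).graph ↔ m.sqrtGreen y = x :=
  mem_graph_pinv_of_ker_eq_bot m.isPositive_sqrtGreen.isSelfAdjoint (m.ker_sqrtGreen hd)

theorem domain_pinv_sqrtGreen (hd : Dense (q.domain : Set H)) :
    (pinv m.sqrtGreen).domain = m.incl.range := by
  rw [domain_pinv, orthogonal_range_of_isSelfAdjoint m.isPositive_sqrtGreen.isSelfAdjoint,
    m.ker_sqrtGreen hd, sup_bot_eq, m.range_sqrtGreen]

theorem toOperator_closure_eq_pinv (hd : Dense (q.domain : Set H)) (hq : q.IsClosable) :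
    (q.closure hq).toOperator = pinv m.green := by
  refine LinearPMap.eq_of_eq_graph (Submodule.ext fun ⟨x, y⟩ => ?_)
  have hmem (k : K) : m.incl k ∈ q.closureDomain := m.closureDomain_eq ▸ ⟨k, rfl⟩
  have hform (k l : K) :
      (q.closure hq).form ⟨m.incl l, hmem l⟩ ⟨m.incl k, hmem k⟩ = inner ℂ l k :=
    m.closureVal_eq hq rfl rfl
  rw [mem_graph_toOperator (q := q.closure hq) (hd.mono domain_le_closureDomain),
    m.mem_graph_pinv_green hd]
  constructor
  · rintro ⟨hx, h⟩
    obtain ⟨k, rfl⟩ := m.closureDomain_eq.le hx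
    refine congrArg m.incl (ext_inner_left ℂ fun l => ?_)
    exact (m.incl.adjoint_inner_right l y).trans
      ((h ⟨m.incl l, hmem l⟩).symm.trans (hform k l))
  · rintro rfl
    refine ⟨hmem _, fun ⟨g, hg⟩ => ?_⟩
    obtain ⟨l, rfl⟩ := m.closureDomain_eq.le hg
    exact (hform _ _).trans (m.incl.adjoint_inner_right _ _)

end EnergyCompletion

end NonnegForm

namespace UnboundedOperator

open NonnegForm

section RangeClosure

variable {𝕜 E F : Type*} [RCLike 𝕜] [NormedAddCommGroup E] [InnerProductSpace 𝕜 E]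
  [NormedAddCommGroup F] [InnerProductSpace 𝕜 F] {T : E →ₗ.[𝕜] F}

/-- The closure of the range of an unbounded operator. -/
def rangeClosure (T : E →ₗ.[𝕜] F) : Submodule 𝕜 F := (LinearMap.range T.toFun).topologicalClosure

instance [CompleteSpace F] : CompleteSpace (rangeClosure T) :=
  inferInstanceAs (CompleteSpace (LinearMap.range T.toFun).topologicalClosure)

theorem apply_mem_rangeClosure (f : T.domain) : T f ∈ rangeClosure T :=
  Submodule.le_topologicalClosure _ ⟨f, rfl⟩

theorem orthogonal_rangeClosure : (rangeClosure T)ᗮ = (LinearMap.range T.toFun)ᗮ :=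
  Submodule.orthogonal_closure _

theorem mem_orthogonal_rangeClosure {x : F} :
    x ∈ (rangeClosure T)ᗮ ↔ ∀ f : T.domain, inner 𝕜 (T f) x = 0 := by
  rw [orthogonal_rangeClosure, Submodule.mem_orthogonal]
  exact ⟨fun h f => h _ ⟨f, rfl⟩, fun h _ ⟨f, hf⟩ => hf ▸ h f⟩

theorem kernel_adjoint {H : Type*} [NormedAddCommGroup H] [InnerProductSpace ℂ H] [CompleteSpace H]
    {S : H →ₗ.[ℂ] H} (hS : Dense (S.domain : Set H)) :
    S.adjoint.kernel = (rangeClosure S)ᗮ := by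
  ext x
  simp only [mem_kernel, mem_graph_adjoint_iff_forall_domain hS, mem_orthogonal_rangeClosure,
    inner_zero_right]

end RangeClosure

section Projection

theorem mem_range_sup {R E F : Type*} [Ring R] [AddCommGroup E] [Module R E] [AddCommGroup F]
    [Module R F] {A : E →ₗ[R] F} {N : Submodule R F} {x : F} :
    x ∈ LinearMap.range A ⊔ N ↔ ∃ w, x - A w ∈ N := by
  rw [Submodule.mem_sup]
  constructor
  · rintro ⟨_, ⟨w, rfl⟩, n, hn, rfl⟩
    exact ⟨w, by simpa using hn⟩
  · rintro ⟨w, hw⟩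
    exact ⟨A w, ⟨w, rfl⟩, x - A w, hw, add_sub_cancel _ _⟩

variable {𝕜 E F : Type*} [RCLike 𝕜] [NormedAddCommGroup E] [InnerProductSpace 𝕜 E]
  [NormedAddCommGroup F] [InnerProductSpace 𝕜 F] {M : Submodule 𝕜 F} [M.HasOrthogonalProjection]

theorem sub_starProjection_mem_orthogonal_iff {x y : F} :
    x - M.starProjection y ∈ Mᗮ ↔ x - y ∈ Mᗮ := by
  rw [← Submodule.sub_mem_iff_left Mᗮ (M.sub_starProjection_mem_orthogonal y),
    sub_sub_sub_cancel_right]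

theorem range_starProjection_comp_sup_orthogonal (A : E →L[𝕜] F) :
    (M.starProjection ∘L A).range ⊔ Mᗮ = A.range ⊔ Mᗮ := by
  ext x
  rw [mem_range_sup, mem_range_sup]
  exact exists_congr fun w => sub_starProjection_mem_orthogonal_iff

end Projection

section Extensions

variable {H K : Type*} [NormedAddCommGroup H] [InnerProductSpace ℂ H] [CompleteSpace H]
  [NormedAddCommGroup K] [InnerProductSpace ℂ K] [CompleteSpace K]
  {S : H →ₗ.[ℂ] H} {hS : S.IsStrictlyPositiveSymmetric} (m : (S.symmForm hS).EnergyCompletion K)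

theorem adjoint_incl_apply (f : S.domain) : m.incl.adjoint (S f) = m.emb f := by
  refine m.denseRange_emb.eq_of_inner_right ℂ fun g => ?_
  rw [m.incl.adjoint_inner_right, m.incl_emb]
  exact (m.inner_emb g f).symm

theorem green_apply (f : S.domain) : m.green (S f) = f :=
  (congrArg m.incl (adjoint_incl_apply m f)).trans (m.incl_emb f)

theorem denseRange_adjoint_incl : DenseRange fun f : S.domain => m.incl.adjoint (S f) := by
  simp only [adjoint_incl_apply]
  exact m.denseRange_emb

theorem eq_zero_of_incl_mem_orthogonal {k : K} (hk : m.incl k ∈ (rangeClosure S)ᗮ) : k = 0 := by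
  refine (denseRange_adjoint_incl m).eq_zero_of_inner_right ℂ fun f => ?_
  rw [m.incl.adjoint_inner_left]
  exact mem_orthogonal_rangeClosure.1 hk f

theorem disjoint_range_incl : Disjoint m.incl.range (rangeClosure S)ᗮ := by
  rw [Submodule.disjoint_def]
  rintro _ ⟨k, rfl⟩ hk
  rw [eq_zero_of_incl_mem_orthogonal m hk, map_zero]

theorem incl_injective : Function.Injective m.incl :=
  (injective_iff_map_eq_zero m.incl).2 fun _ hk =>
    eq_zero_of_incl_mem_orthogonal m (hk ▸ zero_mem _)

theorem green_mem_graph_adjoint (y : H) : (m.green y, y) ∈ S.adjoint.graph := by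
  rw [mem_graph_adjoint_iff_forall_domain hS.1]
  intro f
  rw [← m.isPositive_green.inner_left_eq_inner_right, green_apply]

theorem le_pinv_green : S ≤ pinv m.green := by
  refine LinearPMap.le_of_le_graph fun ⟨x, y⟩ hxy => ?_
  obtain ⟨f, rfl, rfl⟩ := S.mem_graph_iff.1 hxy
  exact (m.mem_graph_pinv_green hS.1).2 (green_apply m f)

theorem friedrichs_eq_pinv : S.friedrichs hS = pinv m.green := by
  refine LinearPMap.eq_of_eq_graph (Submodule.ext fun ⟨x, y⟩ => ?_)
  rw [LinearPMap.friedrichs, mem_graph_domRestrict, m.mem_graph_pinv_green hS.1,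
    m.closureDomain_eq]
  constructor
  · rintro ⟨⟨k, rfl⟩, h⟩
    refine congrArg m.incl ((denseRange_adjoint_incl m).eq_of_inner_right ℂ fun f => ?_)
    calc inner ℂ (m.incl.adjoint (S f)) (m.incl.adjoint y)
        = inner ℂ (m.green (S f)) y := m.incl.adjoint_inner_right _ _
      _ = inner ℂ (f : H) y := by rw [green_apply]
      _ = inner ℂ (S f) (m.incl k) :=
        ((mem_graph_adjoint_iff_forall_domain hS.1).1 h f).symm
      _ = inner ℂ (m.incl.adjoint (S f)) k := (m.incl.adjoint_inner_left _ _).symm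
  · rintro rfl
    exact ⟨⟨_, rfl⟩, green_mem_graph_adjoint m y⟩

theorem isClosable_of_isStrictlyPositiveSymmetric (hS : S.IsStrictlyPositiveSymmetric) :
    S.IsClosable :=
  (LinearPMap.adjoint_isClosed hS.1).isClosable.leIsClosable (hS.2.1.le_adjoint hS.1)

theorem mem_graph_closure {x y : H} :
    (x, y) ∈ S.closure.graph ↔ y ∈ rangeClosure S ∧ m.green y = x := by
  rw [← (isClosable_of_isStrictlyPositiveSymmetric hS).graph_closure_eq_closure_graph]
  constructor
  · intro h
    have hclosed : IsClosed {p : H × H | p.2 ∈ rangeClosure S ∧ m.green p.2 = p.1} :=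
      ((Submodule.isClosed_topologicalClosure _).preimage continuous_snd).inter
        (isClosed_eq (by fun_prop) (by fun_prop))
    refine closure_minimal (s := (S.graph : Set (H × H))) ?_ hclosed h
    rintro ⟨a, b⟩ hab
    obtain ⟨f, rfl, rfl⟩ := S.mem_graph_iff.1 hab
    exact ⟨apply_mem_rangeClosure f, green_apply m f⟩
  · rintro ⟨hy, rfl⟩
    refine map_mem_closure (t := (S.graph : Set (H × H))) (f := fun y => (m.green y, y))
      (by fun_prop) hy ?_
    rintro _ ⟨f, rfl⟩
    exact S.mem_graph_iff.2 ⟨f, (green_apply m f).symm, rfl⟩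

theorem mem_graph_krein {x y : H} :
    (x, y) ∈ S.krein.graph ↔ y ∈ rangeClosure S ∧ x - m.green y ∈ (rangeClosure S)ᗮ := by
  rw [LinearPMap.krein, mem_graph_domRestrict, ← kernel_adjoint hS.1, Submodule.mem_sup]
  constructor
  · rintro ⟨⟨f, hf, n, hn, rfl⟩, hxy⟩
    obtain ⟨w, hw⟩ := LinearPMap.mem_domain_iff.1 hf
    obtain ⟨hwM, rfl⟩ := (mem_graph_closure m).1 hw
    have hadj := add_mem (green_mem_graph_adjoint m w) (mem_kernel.1 hn)
    obtain rfl : w = y := by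
      simpa using S.adjoint.mem_graph_snd_inj hadj hxy rfl
    exact ⟨hwM, by simpa using hn⟩
  · rintro ⟨hy, hn⟩
    refine ⟨⟨m.green y, LinearPMap.mem_domain_of_mem_graph ((mem_graph_closure m).2 ⟨hy, rfl⟩),
      x - m.green y, hn, add_sub_cancel _ _⟩, ?_⟩
    simpa using add_mem (green_mem_graph_adjoint m y) (mem_kernel.1 hn)

/-- The inclusion of the energy completion of `S` followed by the orthogonal projection onto the
closure of `ran S`. It plays for the Kreĭn–von Neumann extension the role that the inclusion plays
for the Friedrichs extension. -/
def kreinIncl : K →L[ℂ] H := (rangeClosure S).starProjection ∘L m.incl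

theorem adjoint_kreinIncl :
    (kreinIncl m).adjoint = m.incl.adjoint ∘L (rangeClosure S).starProjection := by
  rw [kreinIncl, ContinuousLinearMap.adjoint_comp, (isSelfAdjoint_starProjection _).adjoint_eq]

theorem ker_adjoint_kreinIncl : (kreinIncl m).adjoint.ker = (rangeClosure S)ᗮ := by
  have hker : m.incl.adjoint.ker = ⊥ := by
    rw [← m.incl.ker_self_comp_adjoint]
    exact m.ker_green hS.1
  ext x
  rw [adjoint_kreinIncl, LinearMap.mem_ker, ← Submodule.starProjection_apply_eq_zero_iff]
  exact map_eq_zero_iff m.incl.adjoint (LinearMap.ker_eq_bot.1 hker)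

theorem krein_eq_pinv : S.krein = pinv (kreinIncl m ∘L (kreinIncl m).adjoint) := by
  refine LinearPMap.eq_of_eq_graph (Submodule.ext fun ⟨x, y⟩ => ?_)
  rw [mem_graph_krein m,
    mem_graph_pinv_of_isSelfAdjoint (kreinIncl m).isPositive_self_comp_adjoint.isSelfAdjoint,
    ContinuousLinearMap.ker_self_comp_adjoint, ker_adjoint_kreinIncl,
    Submodule.orthogonal_orthogonal]
  refine and_congr_right fun hy => ?_
  have happly : (kreinIncl m ∘L (kreinIncl m).adjoint) y =
      (rangeClosure S).starProjection (m.green y) := by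
    rw [ContinuousLinearMap.comp_apply, adjoint_kreinIncl, ContinuousLinearMap.comp_apply,
      Submodule.starProjection_eq_self_iff.2 hy]
    rfl
  rw [happly, sub_starProjection_mem_orthogonal_iff]

theorem sqrtOp_friedrichs_eq_pinv : (S.friedrichs hS).sqrtOp = pinv m.sqrtGreen := by
  rw [friedrichs_eq_pinv m, m.sqrtOp_pinv_green]

theorem domain_sqrtOp_friedrichs : (S.friedrichs hS).sqrtOp.domain = m.incl.range := by
  rw [sqrtOp_friedrichs_eq_pinv m, m.domain_pinv_sqrtGreen hS.1]

theorem domain_sqrtOp_krein : S.krein.sqrtOp.domain = m.incl.range ⊔ (rangeClosure S)ᗮ := by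
  rw [krein_eq_pinv m, domain_sqrtOp_pinv_comp_adjoint_self, ContinuousLinearMap.orthogonal_range,
    ker_adjoint_kreinIncl, kreinIncl, range_starProjection_comp_sup_orthogonal]

end Extensions

section Accretive

variable {H : Type*} [NormedAddCommGroup H] [InnerProductSpace ℂ H] {S B : H →ₗ.[ℂ] H}

theorem isDissipative_I_smul (hS : S.IsStrictlyPositiveSymmetric) :
    (Complex.I • S).IsDissipative := by
  refine ⟨hS.1, fun f => ?_⟩
  rw [LinearPMap.smul_apply, inner_smul_right, Complex.I_mul_im]
  exact (S.symmForm hS).nonneg f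

theorem imForm_I_smul_apply (hB : (Complex.I • B).IsDissipative) (f g : B.domain) :
    ((Complex.I • B).imForm hB).form f g = (inner ℂ (f : H) (B g) + inner ℂ (B f) (g : H)) / 2 := by
  change (inner ℂ (f : H) (Complex.I • B g) - inner ℂ (Complex.I • B f) (g : H)) /
    (2 * Complex.I) = _
  rw [inner_smul_right, inner_smul_left, Complex.conj_I]
  field_simp
  ring

theorem imForm_I_smul_eq_symmForm (hS : S.IsStrictlyPositiveSymmetric)
    (hA : (Complex.I • S).IsDissipative) : (Complex.I • S).imForm hA = S.symmForm hS := by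
  have h : ((Complex.I • S).imForm hA).form = (S.symmForm hS).form := by
    refine LinearMap.ext₂ fun f g => (imForm_I_smul_apply hA f g).trans ?_
    rw [hS.2.1 f g, add_self_div_two]
    rfl
  change NonnegForm.mk _ _ _ _ = NonnegForm.mk _ _ _ _
  congr 1

theorem quad_imForm_I_smul (hB : (Complex.I • B).IsDissipative) (f : B.domain) :
    ((Complex.I • B).imForm hB).quad f = (inner ℂ (f : H) (B f)).re := by
  refine (congrArg Complex.re (imForm_I_smul_apply hB f f)).trans ?_
  rw [← inner_conj_symm (B f), Complex.add_conj]
  simp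

theorem norm_inner_add_inner_le (hB : (Complex.I • B).IsDissipative) (f g : B.domain) :
    ‖inner ℂ (f : H) (B g) + inner ℂ (B f) (g : H)‖ ≤
      2 * (√(inner ℂ (f : H) (B f)).re * √(inner ℂ (g : H) (B g)).re) := by
  have h := norm_form_le (q := (Complex.I • B).imForm hB) f g
  rw [imForm_I_smul_apply, quad_imForm_I_smul, quad_imForm_I_smul, norm_div, Complex.norm_two,
    div_le_iff₀' two_pos] at h
  exact h

variable [CompleteSpace H] {K : Type*} [NormedAddCommGroup K] [InnerProductSpace ℂ K]
  [CompleteSpace K] {hS : S.IsStrictlyPositiveSymmetric} (m : (S.symmForm hS).EnergyCompletion K)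

theorem sqrt_re_inner_apply (g : S.domain) :
    √(inner ℂ (g : H) (S g)).re = ‖m.incl.adjoint (S g)‖ := by
  rw [adjoint_incl_apply]
  exact (congrArg Real.sqrt (m.quad_eq g)).trans (Real.sqrt_sq (norm_nonneg _))

theorem norm_inner_apply_le_of_isAccretive (hB : B.IsAccretive) (hSB : S ≤ B) (f : B.domain)
    (g : S.domain) : ‖inner ℂ (f : H) (S g)‖ ≤
      (2 * √(inner ℂ (f : H) (B f)).re + ‖m.incl.adjoint (B f)‖) * ‖m.incl.adjoint (S g)‖ := by
  have hBg : B ⟨g, hSB.1 g.2⟩ = S g := (hSB.2 rfl).symm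
  have hform := norm_inner_add_inner_le hB f ⟨g, hSB.1 g.2⟩
  rw [hBg, sqrt_re_inner_apply m] at hform
  have hgreen : ‖inner ℂ (B f) (g : H)‖ ≤ ‖m.incl.adjoint (B f)‖ * ‖m.incl.adjoint (S g)‖ := by
    rw [← green_apply m g]
    refine (congrArg norm (m.incl.adjoint_inner_left _ _)).ge.trans ?_
    exact norm_inner_le_norm _ _
  calc ‖inner ℂ (f : H) (S g)‖
      ≤ ‖inner ℂ (f : H) (S g) + inner ℂ (B f) (g : H)‖ + ‖inner ℂ (B f) (g : H)‖ :=
        norm_le_add_norm_add _ _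
    _ ≤ 2 * (√(inner ℂ (f : H) (B f)).re * ‖m.incl.adjoint (S g)‖) +
        ‖m.incl.adjoint (B f)‖ * ‖m.incl.adjoint (S g)‖ := add_le_add hform hgreen
    _ = _ := by ring

include m in
theorem domain_le_domain_sqrtOp_krein (hB : B.IsAccretive) (hSB : S ≤ B) :
    B.domain ≤ S.krein.sqrtOp.domain := by
  intro f hf
  rw [domain_sqrtOp_krein m, mem_range_sup, orthogonal_rangeClosure]
  refine exists_sub_apply_mem_orthogonal m.incl _ f
    (2 * √(inner ℂ f (B ⟨f, hf⟩)).re + ‖m.incl.adjoint (B ⟨f, hf⟩)‖) ?_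
  rintro _ ⟨g, rfl⟩
  exact norm_inner_apply_le_of_isAccretive m hB hSB ⟨f, hf⟩ g

end Accretive

section ImaginaryPart

variable {H K : Type*} [NormedAddCommGroup H] [InnerProductSpace ℂ H] [CompleteSpace H]
  [NormedAddCommGroup K] [InnerProductSpace ℂ K] [CompleteSpace K]
  {S : H →ₗ.[ℂ] H} {hS : S.IsStrictlyPositiveSymmetric} (m : (S.symmForm hS).EnergyCompletion K)
  (hA : (Complex.I • S).IsDissipative)

include m in
theorem isClosable_imForm_I_smul : ((Complex.I • S).imForm hA).IsClosable := by
  rw [imForm_I_smul_eq_symmForm hS]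
  exact m.isClosable (incl_injective m)

variable (hq : ((Complex.I • S).imForm hA).IsClosable)

theorem imPart_I_smul_eq_pinv : (Complex.I • S).imPart hA hq = pinv m.green := by
  simp only [LinearPMap.imPart, imForm_I_smul_eq_symmForm hS]
  exact m.toOperator_closure_eq_pinv hS.1 _

theorem mem_graph_wOp {x y : H} : (x, y) ∈ ((Complex.I • S).wOp hA hq).graph ↔
    ∃ f : S.domain, m.sqrtGreen (S f) = x ∧ Complex.I • S f = y := by
  have hinj : Function.Injective m.sqrtGreen := LinearMap.ker_eq_bot.1 (m.ker_sqrtGreen hS.1)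
  have hsqrt (f : S.domain) : m.sqrtGreen (m.sqrtGreen (S f)) = f :=
    (congrArg (· (S f)) m.sqrtGreen_mul_self).trans (green_apply m f)
  have hinv {a b : H} : (a, b) ∈ ((pinv m.sqrtGreen).domRestrict S.domain).inverse.graph ↔
      b ∈ S.domain ∧ m.sqrtGreen a = b :=
    mem_graph_inverse_domRestrict_pinv m.isPositive_sqrtGreen.isSelfAdjoint (m.ker_sqrtGreen hS.1)
  rw [LinearPMap.wOp, imPart_I_smul_eq_pinv m hA hq, m.sqrtOp_pinv_green, mem_graph_mulOp]
  simp only [mem_graph_smul]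
  constructor
  · rintro ⟨z, hz, w, hw, rfl⟩
    obtain ⟨hz, hxz⟩ := hinv.1 hz
    obtain ⟨f, rfl, rfl⟩ := S.mem_graph_iff.1 hw
    exact ⟨f, hinj ((hsqrt f).trans hxz.symm), rfl⟩
  · rintro ⟨f, rfl, rfl⟩
    exact ⟨f, hinv.2 ⟨f.2, hsqrt f⟩, S f, S.mem_graph f, rfl⟩

include m in
theorem dense_domain_wOp : Dense (((Complex.I • S).wOp hA hq).domain : Set H) := by
  rw [Submodule.dense_iff_topologicalClosure_eq_top, Submodule.topologicalClosure_eq_top_iff,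
    Submodule.eq_bot_iff]
  intro g hg
  have hmem : m.sqrtGreen g ∈ (rangeClosure S)ᗮ := by
    rw [mem_orthogonal_rangeClosure]
    intro f
    rw [← m.isPositive_sqrtGreen.inner_left_eq_inner_right]
    exact hg _ (LinearPMap.mem_domain_of_mem_graph ((mem_graph_wOp m hA hq).2 ⟨f, rfl, rfl⟩))
  have hzero : m.sqrtGreen g = 0 :=
    Submodule.disjoint_def.1 (disjoint_range_incl m) _ (m.range_sqrtGreen.le ⟨g, rfl⟩) hmem
  exact LinearMap.ker_eq_bot'.1 (m.ker_sqrtGreen hS.1) g hzero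

theorem mem_graph_adjoint_wOp {x y : H} : (x, y) ∈ ((Complex.I • S).wOp hA hq).adjoint.graph ↔
    x - m.sqrtGreen (Complex.I • y) ∈ (rangeClosure S)ᗮ := by
  have hinner (f : S.domain) : inner ℂ (S f) (x - m.sqrtGreen (Complex.I • y)) =
      Complex.I * (inner ℂ (Complex.I • S f) x - inner ℂ (m.sqrtGreen (S f)) y) := by
    rw [inner_sub_right, map_smul, inner_smul_right, inner_smul_left, Complex.conj_I,
      m.isPositive_sqrtGreen.inner_left_eq_inner_right]
    linear_combination inner ℂ (S f) x * Complex.I_mul_I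
  rw [mem_graph_adjoint (dense_domain_wOp m hA hq), mem_orthogonal_rangeClosure]
  simp only [hinner, mul_eq_zero, Complex.I_ne_zero, false_or, sub_eq_zero, mem_graph_wOp m hA hq]
  exact ⟨fun h f => h _ _ ⟨f, rfl, rfl⟩, fun h _ _ ⟨f, hf, hf'⟩ => hf ▸ hf' ▸ h f⟩

include m in
theorem domain_adjoint_wOp :
    ((Complex.I • S).wOp hA hq).adjoint.domain = S.krein.sqrtOp.domain := by
  ext x
  rw [domain_sqrtOp_krein m, ← m.range_sqrtGreen, mem_range_sup, LinearPMap.mem_domain_iff]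
  simp only [mem_graph_adjoint_wOp m hA hq]
  exact ((MulAction.surjective₀ (α := H) Complex.I_ne_zero).exists
    (p := fun w => x - m.sqrtGreen w ∈ (rangeClosure S)ᗮ)).symm

theorem adjoint_wOp_eq : ((Complex.I • S).wOp hA hq).adjoint =
    (-Complex.I) • (pinv m.sqrtGreen).mulOp
      (LinearPMap.projAlong (pinv m.sqrtGreen).domain (rangeClosure S)ᗮ) := by
  refine LinearPMap.eq_of_eq_graph (Submodule.ext fun ⟨x, y⟩ => ?_)
  rw [m.domain_pinv_sqrtGreen hS.1]
  simp only [mem_graph_adjoint_wOp m hA hq, mem_graph_smul, mem_graph_mulOp,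
    mem_graph_projAlong (disjoint_range_incl m), m.mem_graph_pinv_sqrtGreen hS.1]
  constructor
  · intro h
    refine ⟨Complex.I • y, ⟨_, ⟨m.range_sqrtGreen.le ⟨_, rfl⟩, h⟩, rfl⟩, ?_⟩
    rw [smul_smul, neg_mul, Complex.I_mul_I, neg_neg, one_smul]
  · rintro ⟨w, ⟨z, ⟨-, h⟩, rfl⟩, rfl⟩
    rwa [smul_smul, mul_neg, Complex.I_mul_I, neg_neg, one_smul]

end ImaginaryPart

end UnboundedOperator

end

open UnboundedOperator

theorem lemma4p5 {H : Type*} [NormedAddCommGroup H] [InnerProductSpace ℂ H] [CompleteSpace H]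
    (S : H →ₗ.[ℂ] H) (hS : S.IsStrictlyPositiveSymmetric) :
    -- the Friedrichs extension is a strictly positive selfadjoint extension of `S`
    (S ≤ S.friedrichs hS ∧ IsSelfAdjoint (S.friedrichs hS) ∧
      (S.friedrichs hS).IsStrictlyPositiveSymmetric) ∧
    -- the operators denoted `S_F^{1/2}` and `S_K^{1/2}` are indeed the square roots
    (S.friedrichs hS).IsNonnegSqrt (S.friedrichs hS).sqrtOp ∧
    S.krein.IsNonnegSqrt S.krein.sqrtOp ∧
    -- `A = i S` is dissipative with closable `q_A`, and `V_A = S_F`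
    (∃ (hA : (Complex.I • S).IsDissipative) (hq : ((Complex.I • S).imForm hA).IsClosable),
      (Complex.I • S).imPart hA hq = S.friedrichs hS ∧
      -- `W_A` is densely defined, and its adjoint is as claimed
      Dense (((Complex.I • S).wOp hA hq).domain : Set H) ∧
      ((Complex.I • S).wOp hA hq).adjoint.domain = S.krein.sqrtOp.domain ∧
      S.krein.sqrtOp.domain = (S.friedrichs hS).sqrtOp.domain ⊔ S.adjoint.kernel ∧
      Disjoint (S.friedrichs hS).sqrtOp.domain S.adjoint.kernel ∧
      ((Complex.I • S).wOp hA hq).adjoint = (-Complex.I) • (S.friedrichs hS).sqrtOp.mulOp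
        (LinearPMap.projAlong (S.friedrichs hS).sqrtOp.domain S.adjoint.kernel)) ∧
    -- every accretive extension of `S` has its domain inside `D(S_K^{1/2})`
    ∀ B : H →ₗ.[ℂ] H, S ≤ B → B.IsAccretive → B.domain ≤ S.krein.sqrtOp.domain := by
  obtain ⟨ε, hε, h⟩ := hS.2.2
  let m := (S.symmForm hS).energyCompletion hε h
  have hA := isDissipative_I_smul hS
  have hq := isClosable_imForm_I_smul m hA
  have hF : S.friedrichs hS = pinv m.green := friedrichs_eq_pinv m
  have hN : S.adjoint.kernel = (rangeClosure S)ᗮ := kernel_adjoint hS.1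
  have hFdom : (S.friedrichs hS).sqrtOp.domain = m.incl.range := domain_sqrtOp_friedrichs m
  refine ⟨⟨?_, ?_, ?_⟩, ?_, ?_, ⟨hA, hq, ?_, dense_domain_wOp m hA hq, domain_adjoint_wOp m hA hq,
    ?_, ?_, ?_⟩, fun B hSB hB => domain_le_domain_sqrtOp_krein m hB hSB⟩
  · exact hF ▸ le_pinv_green m
  · exact hF ▸ isSelfAdjoint_pinv m.isPositive_green.isSelfAdjoint
  · exact hF ▸ m.isStrictlyPositiveSymmetric_pinv_green hS.1 hε h
  · exact hF ▸ isNonnegSqrt_sqrtOp_pinv m.isPositive_green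
  · exact krein_eq_pinv m ▸ isNonnegSqrt_sqrtOp_pinv (kreinIncl m).isPositive_self_comp_adjoint
  · exact (imPart_I_smul_eq_pinv m hA hq).trans hF.symm
  · rw [hFdom, hN, domain_sqrtOp_krein m]
  · exact hFdom ▸ hN ▸ disjoint_range_incl m
  · rw [hN, sqrtOp_friedrichs_eq_pinv m, adjoint_wOp_eq m hA hq]
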